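/- Let $\alpha,\eta,\rho>0$. Let the single-user channel gain $\gamma_s$ be exponential with unit mean (Rayleigh fading), with distribution function $F(x)=1-e^{-x}$ and density $f(x)=e^{-x}$ for $x\ge 0$. Let the instantaneous error rate at instantaneous SNR $x$ be either (i) $P_e(x)=\alpha e^{-\eta x}$, or (ii) $P_e(x)=\alpha Q(\sqrt{\eta x})$ with $Q(x)=\frac1{\sqrt{2\pi}}\int_x^\infty e^{-s^2/2}\,ds$. For real $N\ge 0$ let $$\overline{P}_e(\rho,N)=\int_{[0,\infty)}P_e(\rho x)\,dF^N(x)$$ be the error rate averaged over the gain of the best of $N$ users (for $N=0$, $dF^0$ is the unit mass at $0$). With $B=-P_e'$ put $$t(u)=\frac{\rho\,B\bigl(\rho F^{-1}(e^{-u})\bigr)\,e^{-u}}{f\bigl(F^{-1}(e^{-u})\bigr)},\qquad u>0.$$ A function $\psi$ on $(0,\infty)$ is called regularly varying with exponent $\mu\in\mathbb{R}$ at $\infty$ (at $0$) if $\psi(s)=s^\mu l(s)$ where $l(\kappa s)/l(s)\to1$ as $s\to\infty$ ($s\to0^+$) for every $\kappa>0$; the exponent $\mu=0$ (slow variation) is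 allowed. A function $\tau$ is completely monotonic on $(0,\infty)$ if it is smooth there and $(-1)^k\tau^{(k)}(x)\ge0$ for all $k\ge0$ and $x>0$. Put $\nu=\eta\rho$ in case (i) and $\nu=\eta\rho/2$ in case (ii). Then in each case: 1. $t$ is regularly varying at $0$ with exponent $\nu-1$; 2. $N\mapsto\overline{P}_e(\rho,N)$ is completely monotonic on $(0,\infty)$; 3. $N\mapsto\overline{P}_e(\rho,N)$ is regularly varying at $\infty$ with exponent $-\nu$; 4. if $\mathcal N$ is Poisson with mean $\lambda$, then $\overline{P}_e(\rho,\mathcal N)$ is integrable for every $\lambda\ge 0$, and as $\lambda\to\infty$ $$\mathrm{E}\bigl[\overline{P}_e(\rho,\mathcal N)\bigr]=\overline{P}_e(\rho,\lambda)+O\!\left(\frac{\overline{P}_e(\rho,\lambda)}{\lambda}\right).$$ -/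

import Mathlib

open MeasureTheory ProbabilityTheory Filter Set Topology
open scoped NNReal ContDiff

noncomputable section

/-- `τ` is completely monotonic on `(0, ∞)`: it is smooth there and, for every `k ≥ 0`,
`(-1)^k` times its `k`-th derivative is nonnegative. (`k = 0` says that `τ` is nonnegative.) -/
def CompletelyMonotonic (τ : ℝ → ℝ) : Prop :=
  ContDiffOn ℝ ∞ τ (Ioi 0) ∧ ∀ k : ℕ, ∀ x : ℝ, 0 < x → 0 ≤ (-1) ^ k * iteratedDeriv k τ x

/-- `l` is slowly varying along `F`, where `F` is `atTop` (slow variation at infinity)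
or `𝓝[>] 0` (slow variation at zero). -/
def SlowlyVarying (F : Filter ℝ) (l : ℝ → ℝ) : Prop :=
  ∀ κ : ℝ, 0 < κ → Tendsto (fun s => l (κ * s) / l s) F (𝓝 1)

/-- `ψ` is regularly varying along `F` (`atTop` or `𝓝[>] 0`) with exponent `μ`. -/
def RegularlyVarying (F : Filter ℝ) (μ : ℝ) (ψ : ℝ → ℝ) : Prop :=
  ∃ l : ℝ → ℝ, SlowlyVarying F l ∧ ∀ s : ℝ, 0 < s → ψ s = s ^ μ * l s

/-- The distribution function of the channel gain of the best of `N` users, when the channel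
gain of a single user has law `γ` on `[0, ∞)` with distribution function `cdf γ`: it is
`x ↦ (cdf γ x) ^ N` on `[0, ∞)` and zero on the negative half-line. The exponent `N` may be any
nonnegative real number; for `N = 0` this is the unit mass at `0` (no user, no gain). -/
def bestGainCDF (γ : Measure ℝ) (N : ℝ≥0) : StieltjesFunction ℝ where
  toFun x := if x < 0 then 0 else cdf γ x ^ (N : ℝ)
  mono' := by
    intro x y hxy
    dsimp only
    split_ifs with hx hy hy
    · exact le_rfl
    · exact Real.rpow_nonneg (cdf_nonneg γ y) _
    · exact absurd (lt_of_le_of_lt hxy hy) hx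
    · exact Real.rpow_le_rpow (cdf_nonneg γ x) (monotone_cdf γ hxy) N.2
  right_continuous' := by
    intro x
    by_cases hx : x < 0
    · have h : (fun y : ℝ => if y < 0 then 0 else cdf γ y ^ (N : ℝ)) =ᶠ[𝓝 x] fun _ => 0 := by
        filter_upwards [Iio_mem_nhds hx] with y hy
        exact if_pos hy
      exact (continuousAt_const.congr h.symm).continuousWithinAt
    · have h : ContinuousWithinAt (fun y : ℝ => cdf γ y ^ (N : ℝ)) (Ici x) x :=
        ((cdf γ).right_continuous x).rpow_const (Or.inr N.2)
      refine h.congr (fun y hy => ?_) ?_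
      · exact if_neg (not_lt.mpr (le_trans (not_lt.mp hx) hy))
      · exact if_neg hx

/-- The average error rate `∫₀^∞ Pe(ρ x) dF^N(x)` at average SNR `ρ` with `N ≥ 0` users, where
`F = cdf γ`, as a function of the real variable `N` (only its values for `N ≥ 0` matter). -/
def averageErrorRate (γ : Measure ℝ) (Pe : ℝ → ℝ) (ρ N : ℝ) : ℝ :=
  ∫ x in Ici 0, Pe (ρ * x) ∂(bestGainCDF γ N.toNNReal).measure

/-- The inverse distribution function (quantile function) of `γ`. -/
def inverseCDF (γ : Measure ℝ) (p : ℝ) : ℝ :=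
  sInf {x : ℝ | p ≤ cdf γ x}

/-- The function `t(u) = ρ B(ρ F⁻¹(e^{-u})) e^{-u} / f(F⁻¹(e^{-u}))`, where `B = -Pe'`, `F = cdf γ`
and `f` is the density of `γ`. -/
def mixingDensity (γ : Measure ℝ) (f : ℝ → ℝ) (Pe : ℝ → ℝ) (ρ u : ℝ) : ℝ :=
  ρ * (-deriv Pe (ρ * inverseCDF γ (Real.exp (-u))) * Real.exp (-u)) /
    f (inverseCDF γ (Real.exp (-u)))

/-- The Gaussian tail function `Q(x) = (2π)^{-1/2} ∫ₓ^∞ e^{-s²/2} ds`. -/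
def gaussianQ (x : ℝ) : ℝ :=
  1 / Real.sqrt (2 * Real.pi) * ∫ s in Ioi x, Real.exp (-(s ^ 2) / 2)

/-- The instantaneous error rate `α e^{-η x}` at instantaneous SNR `x`. -/
def expErrorRate (α η x : ℝ) : ℝ := α * Real.exp (-(η * x))

/-- The instantaneous error rate `α Q(√(η x))` at instantaneous SNR `x`. -/
def qErrorRate (α η x : ℝ) : ℝ := α * gaussianQ (Real.sqrt (η * x))

/-- Law of the channel gain under Rayleigh fading: exponential with unit mean. -/
def rayleighGain : Measure ℝ := expMeasure 1

/-- Density of the channel gain under Rayleigh fading. -/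
def rayleighGainPDF : ℝ → ℝ := exponentialPDFReal 1

/-- `E[P̄ₑ(ρ, 𝒩)]` for a Poisson number of users `𝒩` with mean `lam`. -/
def poissonErrorRate (γ : Measure ℝ) (Pe : ℝ → ℝ) (ρ : ℝ) (lam : ℝ≥0) : ℝ :=
  ∫ n : ℕ, averageErrorRate γ Pe ρ (n : ℝ) ∂(poissonMeasure lam)

end

/-! Integration by parts gives `P̄ₑ(N) = ∫ F(y)^N ρ B(ρ y) dy`, and the substitution `F(y) = e^{-u}`
makes this the Laplace transform of `t` at `N` (`averageErrorRate_rayleigh_eq_laplaceTransform`).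
Complete monotonicity is then just positivity of `t`.

In both cases `B(x) = C x^{-a} e^{-β x}`, with `(a, β) = (0, η)` or `(1/2, η/2)`. Since `F⁻¹(e^{-u})
= -log (1 - e^{-u})`, the exponential becomes the power `(1 - e^{-u})^{βρ}` and `x^{-a}` a slowly
varying power of a logarithm; so `t` has exponent `βρ - 1` at `0`
(`tendsto_mixingDensity_rayleigh_ratio`). An Abelian theorem (`tendsto_laplaceTransform_ratio`)
transfers this to infinity: the part of the integral over `u ≥ δ` is negligible for every `δ > 0`.

A Poisson number of users replaces `e^{-λu}` by `e^{-λ(1 - e^{-u})}`. The difference is at most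
`(16/λ) e^{-λu/4} + e^{-λ/2}` (`exp_poisson_sub_exp_bounds`), and regular variation bounds the
transform at `λ/4` by a constant times that at `λ`. -/

/-! ### Laplace transforms of positive integrable functions and an Abelian theorem -/

/-- The Laplace transform of `t : (0, ∞) → ℝ`. -/
noncomputable def laplaceTransform (t : ℝ → ℝ) (N : ℝ) : ℝ :=
  ∫ u in Ioi 0, Real.exp (-(N * u)) * t u

/-- A function in `L¹(0, ∞)` stays integrable after multiplication by a continuous function
with values in `[0, 1]`. -/
lemma integrableOn_continuous_mul_of_le_one {t g : ℝ → ℝ} (ht : IntegrableOn t (Ioi 0))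
    (hg : Continuous g) (h0 : ∀ u, 0 < u → 0 ≤ g u) (h1 : ∀ u, 0 < u → g u ≤ 1) :
    IntegrableOn (fun u => g u * t u) (Ioi 0) := by
  refine Integrable.bdd_mul (c := 1) ht hg.aestronglyMeasurable ?_
  filter_upwards [ae_restrict_mem measurableSet_Ioi] with u hu
  rw [Real.norm_eq_abs, abs_of_nonneg (h0 u hu)]
  exact h1 u hu

lemma integrableOn_laplace {t : ℝ → ℝ} (ht : IntegrableOn t (Ioi 0)) {N : ℝ} (hN : 0 ≤ N) :
    IntegrableOn (fun u => Real.exp (-(N * u)) * t u) (Ioi 0) :=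
  integrableOn_continuous_mul_of_le_one ht (by fun_prop) (fun u _ => (Real.exp_pos _).le) fun u hu =>
    Real.exp_le_one_iff.2 (by have := mul_nonneg hN (le_of_lt hu); linarith)

lemma setIntegral_Ioc_pos {t : ℝ → ℝ} (ht : IntegrableOn t (Ioi 0)) (hpos : ∀ u, 0 < u → 0 < t u)
    {δ : ℝ} (hδ : 0 < δ) : 0 < ∫ u in Ioc 0 δ, t u := by
  have hint : IntegrableOn t (Ioc 0 δ) := ht.mono_set Ioc_subset_Ioi_self
  rw [← intervalIntegral.integral_of_le hδ.le]
  exact intervalIntegral.intervalIntegral_pos_of_pos_on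
    ((intervalIntegrable_iff_integrableOn_Ioc_of_le hδ.le).2 hint) (fun x hx => hpos x hx.1) hδ

/-- This lower bound is what makes contributions away from `0` negligible: the mass near `0` decays
at a rate `δ` that can be taken as small as desired. -/
lemma exp_mul_setIntegral_le_laplaceTransform {t : ℝ → ℝ} (ht : IntegrableOn t (Ioi 0))
    (hpos : ∀ u, 0 < u → 0 < t u) {δ N : ℝ} (hN : 0 ≤ N) :
    Real.exp (-(N * δ)) * ∫ u in Ioc 0 δ, t u ≤ laplaceTransform t N := by
  have hint := integrableOn_laplace ht hN
  calc Real.exp (-(N * δ)) * ∫ u in Ioc 0 δ, t u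
      = ∫ u in Ioc 0 δ, Real.exp (-(N * δ)) * t u := (integral_const_mul _ _).symm
    _ ≤ ∫ u in Ioc 0 δ, Real.exp (-(N * u)) * t u := by
        refine setIntegral_mono_on ((ht.mono_set Ioc_subset_Ioi_self).const_mul _)
          (hint.mono_set Ioc_subset_Ioi_self) measurableSet_Ioc fun u hu => ?_
        have := mul_le_mul_of_nonneg_left hu.2 hN
        have := (hpos u hu.1).le
        gcongr
    _ ≤ laplaceTransform t N := by
        refine setIntegral_mono_set hint ?_ Ioc_subset_Ioi_self.eventuallyLE
        filter_upwards [ae_restrict_mem measurableSet_Ioi] with u hu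
        exact mul_nonneg (Real.exp_pos _).le (hpos u hu).le

lemma laplaceTransform_pos {t : ℝ → ℝ} (ht : IntegrableOn t (Ioi 0))
    (hpos : ∀ u, 0 < u → 0 < t u) {N : ℝ} (hN : 0 ≤ N) : 0 < laplaceTransform t N :=
  (mul_pos (Real.exp_pos _) (setIntegral_Ioc_pos ht hpos one_pos)).trans_le
    (exp_mul_setIntegral_le_laplaceTransform ht hpos hN)

/-- The Laplace transform of a function that is positive near `0` eventually
dominates `C N e^{-N δ}`, for every `C` and every `δ > 0`. -/
lemma eventually_mul_exp_le_laplaceTransform {t : ℝ → ℝ} (ht : IntegrableOn t (Ioi 0))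
    (hpos : ∀ u, 0 < u → 0 < t u) {δ : ℝ} (hδ : 0 < δ) (C : ℝ) :
    ∀ᶠ N : ℝ in atTop, C * (N * Real.exp (-(N * δ))) ≤ laplaceTransform t N := by
  -- The mass on `(0, δ/2]` decays only like `e^{-Nδ/2}`, which beats `N e^{-Nδ}`.
  have hc := setIntegral_Ioc_pos ht hpos (half_pos hδ)
  have hlim : Tendsto (fun N : ℝ => C * (N * Real.exp (-(δ / 2 * N)))) atTop (𝓝 0) := by
    have h := (tendsto_rpow_mul_exp_neg_mul_atTop_nhds_zero 1 (δ / 2) (half_pos hδ)).const_mul C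
    simpa [neg_mul] using h
  filter_upwards [hlim.eventually_lt_const hc, eventually_ge_atTop 0] with N hN hN0
  refine le_trans ?_ (exp_mul_setIntegral_le_laplaceTransform ht hpos (δ := δ / 2) hN0)
  have he : Real.exp (-(N * δ)) = Real.exp (-(N * (δ / 2))) * Real.exp (-(δ / 2 * N)) := by
    rw [← Real.exp_add]; ring_nf
  calc C * (N * Real.exp (-(N * δ)))
      = Real.exp (-(N * (δ / 2))) * (C * (N * Real.exp (-(δ / 2 * N)))) := by rw [he]; ring
    _ ≤ _ := by gcongr

/-- The behaviour of a Laplace transform at infinity is governed by the function near `0`. -/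
lemma laplaceTransform_isLittleO {t r : ℝ → ℝ} (ht : IntegrableOn t (Ioi 0))
    (hpos : ∀ u, 0 < u → 0 < t u) (hr : IntegrableOn r (Ioi 0)) (hrt : r =o[𝓝[>] 0] t) :
    laplaceTransform r =o[atTop] laplaceTransform t := by
  rw [Asymptotics.isLittleO_iff]
  intro ε hε
  obtain ⟨δ, hδ, hδr⟩ := mem_nhdsGT_iff_exists_Ioo_subset.1
    (Asymptotics.isLittleO_iff.1 hrt (half_pos hε))
  -- The constant is chosen so that the part of `r` beyond `δ` costs at most `ε/2` of the transform
  -- of `t`; the part below `δ` costs the other half.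
  filter_upwards [eventually_mul_exp_le_laplaceTransform ht hpos hδ
    ((∫ u in Ioi 0, |r u|) / (ε / 2)), eventually_ge_atTop 1] with N hN hN1
  have hN0 : 0 ≤ N := zero_le_one.trans hN1
  have hL := laplaceTransform_pos ht hpos hN0
  rw [Real.norm_eq_abs, Real.norm_eq_abs, abs_of_pos hL]
  have hI : 0 ≤ ∫ u in Ioi 0, |r u| := integral_nonneg fun u => abs_nonneg _
  have hbound : |laplaceTransform r N| ≤
      ε / 2 * laplaceTransform t N + Real.exp (-(N * δ)) * ∫ u in Ioi 0, |r u| := by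
    have hit := (integrableOn_laplace ht hN0).const_mul (ε / 2)
    have hir := hr.abs.const_mul (Real.exp (-(N * δ)))
    unfold laplaceTransform
    rw [← integral_const_mul, ← integral_const_mul, ← integral_add hit hir]
    refine abs_integral_le_integral_abs.trans
      (setIntegral_mono_on (integrableOn_laplace hr hN0).abs (hit.add hir) measurableSet_Ioi ?_)
    intro u hu
    have hu : 0 < u := hu
    rw [abs_mul, abs_of_pos (Real.exp_pos _)]
    rcases lt_or_ge u δ with h | h
    · have h1 : |r u| ≤ ε / 2 * t u := by
        have := hδr ⟨hu, h⟩
        simpa [abs_of_pos (hpos u hu)] using this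
      have h2 : 0 ≤ Real.exp (-(N * δ)) * |r u| := by positivity
      have h3 := mul_le_mul_of_nonneg_left h1 (Real.exp_pos (-(N * u))).le
      linarith
    · have h1 : Real.exp (-(N * u)) ≤ Real.exp (-(N * δ)) := by gcongr
      have h2 := mul_le_mul_of_nonneg_right h1 (abs_nonneg (r u))
      have h3 : 0 ≤ ε / 2 * (Real.exp (-(N * u)) * t u) := by
        have := hpos u hu
        positivity
      linarith
  have h4 : Real.exp (-(N * δ)) * ∫ u in Ioi 0, |r u| ≤ ε / 2 * laplaceTransform t N := by
    have h5 : (∫ u in Ioi 0, |r u|) * (N * Real.exp (-(N * δ))) ≤ ε / 2 * laplaceTransform t N := by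
      rw [div_mul_eq_mul_div, div_le_iff₀ (half_pos hε)] at hN
      linarith
    refine le_trans ?_ h5
    rw [mul_comm]
    gcongr
    exact le_mul_of_one_le_left (Real.exp_pos _).le hN1
  linarith

lemma integrableOn_comp_mul {t : ℝ → ℝ} (ht : IntegrableOn t (Ioi 0)) {κ : ℝ} (hκ : 0 < κ) :
    IntegrableOn (fun u => t (κ * u)) (Ioi 0) := by
  simpa using (integrableOn_Ioi_comp_mul_left_iff t 0 hκ).2 (by simpa using ht)

/-- Dilating the argument amounts to dilating `t`, so ratios at infinity become comparisons of
functions near `0`. -/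
lemma laplaceTransform_mul {t : ℝ → ℝ} {κ : ℝ} (hκ : 0 < κ) (N : ℝ) :
    laplaceTransform t (κ * N) = κ⁻¹ * laplaceTransform (fun u => t (κ⁻¹ * u)) N := by
  have h := integral_comp_mul_left_Ioi (fun u => Real.exp (-(N * u)) * t (κ⁻¹ * u)) 0 hκ
  rw [mul_zero, smul_eq_mul] at h
  unfold laplaceTransform
  rw [← h]
  congr 1 with u
  rw [inv_mul_cancel_left₀ hκ.ne']
  ring_nf

/-- An Abelian theorem: regular variation of `t` at `0` carries over to regular variation at
infinity of its Laplace transform. -/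
lemma tendsto_laplaceTransform_ratio {t : ℝ → ℝ} (ht : IntegrableOn t (Ioi 0))
    (hpos : ∀ u, 0 < u → 0 < t u) {ν : ℝ}
    (hreg : ∀ κ : ℝ, 0 < κ → Tendsto (fun u => t (κ * u) / t u) (𝓝[>] 0) (𝓝 (κ ^ (ν - 1))))
    {κ : ℝ} (hκ : 0 < κ) :
    Tendsto (fun N => laplaceTransform t (κ * N) / laplaceTransform t N) atTop
      (𝓝 (κ ^ (-ν))) := by
  -- `c` is the limit of `t (κ⁻¹ u) / t u`. The dilated function is thus `c t + o(t)`, and the limit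
  -- ratio is `κ⁻¹ c = κ^{-ν}`.
  set c : ℝ := κ⁻¹ ^ (ν - 1) with hc
  have hs := integrableOn_comp_mul ht (inv_pos.2 hκ)
  have hr : IntegrableOn (fun u => t (κ⁻¹ * u) - c * t u) (Ioi 0) := hs.sub (ht.const_mul c)
  have hlittle : (fun u => t (κ⁻¹ * u) - c * t u) =o[𝓝[>] 0] t := by
    rw [Asymptotics.isLittleO_iff_tendsto']
    · have h := (hreg κ⁻¹ (inv_pos.2 hκ)).sub_const c
      rw [sub_self] at h
      refine h.congr' ?_
      filter_upwards [self_mem_nhdsWithin] with u hu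
      have := (hpos u hu).ne'
      field_simp
    · filter_upwards [self_mem_nhdsWithin] with u hu h0
      exact absurd h0 (hpos u hu).ne'
  have h := ((laplaceTransform_isLittleO ht hpos hr hlittle).tendsto_div_nhds_zero.add_const
    c).const_mul κ⁻¹
  have hlim : κ⁻¹ * (0 + c) = κ ^ (-ν) := by
    rw [zero_add, hc, Real.inv_rpow hκ.le, ← Real.rpow_neg hκ.le, ← Real.rpow_neg_one,
      ← Real.rpow_add hκ]
    ring_nf
  rw [hlim] at h
  refine h.congr' ?_
  filter_upwards [eventually_ge_atTop 0] with N hN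
  have hL := (laplaceTransform_pos ht hpos hN).ne'
  have hsub : laplaceTransform (fun u => t (κ⁻¹ * u) - c * t u) N =
      laplaceTransform (fun u => t (κ⁻¹ * u)) N - c * laplaceTransform t N := by
    unfold laplaceTransform
    rw [← integral_const_mul, ← integral_sub (integrableOn_laplace hs hN)
      ((integrableOn_laplace ht hN).const_mul c)]
    congr 1 with u
    ring
  rw [laplaceTransform_mul hκ, hsub]
  field_simp
  ring

/-- Regular variation with exponent `μ`, in terms of the ratios `ψ (κ s) / ψ s`. -/
lemma regularlyVarying_of_tendsto {F : Filter ℝ} {ψ : ℝ → ℝ} {μ : ℝ} (hF : ∀ᶠ s in F, 0 < s)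
    (h : ∀ κ : ℝ, 0 < κ → Tendsto (fun s => ψ (κ * s) / ψ s) F (𝓝 (κ ^ μ))) :
    RegularlyVarying F μ ψ := by
  refine ⟨fun s => s ^ (-μ) * ψ s, fun κ hκ => ?_, fun s hs => ?_⟩
  · have h1 := (h κ hκ).const_mul (κ ^ (-μ))
    rw [← Real.rpow_add hκ, neg_add_cancel, Real.rpow_zero] at h1
    refine h1.congr' ?_
    filter_upwards [hF] with s hs
    rw [Real.mul_rpow hκ.le hs.le]
    have := (Real.rpow_pos_of_pos hs (-μ)).ne'
    rw [mul_right_comm, mul_comm (s ^ (-μ)) (ψ s), mul_div_mul_right _ _ this, mul_div_assoc]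
  · rw [← mul_assoc, ← Real.rpow_add hs, add_neg_cancel, Real.rpow_zero, one_mul]

/-! ### Complete monotonicity -/

/-- The Laplace transform of a nonnegative integrable function is completely monotonic. -/
lemma completelyMonotonic_laplaceTransform {t : ℝ → ℝ} (ht : IntegrableOn t (Ioi 0))
    (hnn : ∀ u, 0 < u → 0 ≤ t u) : CompletelyMonotonic (laplaceTransform t) := by
  -- The transform is the moment generating function of `-u` under the measure with density `t`. It
  -- is analytic inside its domain, and its `k`-th derivative integrates `(-u)^k e^{-Nu}`, whose
  -- sign is `(-1)^k`.
  set μ : Measure ℝ := (volume.restrict (Ioi 0)).withDensity (fun u => ENNReal.ofReal (t u)) with hμ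
  have hm : AEMeasurable (fun u => ENNReal.ofReal (t u)) (volume.restrict (Ioi 0)) :=
    ht.aemeasurable.ennreal_ofReal
  have hfin : ∀ᵐ u ∂(volume.restrict (Ioi (0 : ℝ))), ENNReal.ofReal (t u) < ⊤ :=
    ae_of_all _ fun u => ENNReal.ofReal_lt_top
  have hmgf : laplaceTransform t = mgf (fun u => -u) μ := by
    ext N
    rw [mgf, hμ, integral_withDensity_eq_integral_toReal_smul₀ hm hfin]
    refine setIntegral_congr_fun measurableSet_Ioi fun u hu => ?_
    simp only [ENNReal.toReal_ofReal (hnn u hu), smul_eq_mul, mul_neg]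
    rw [mul_comm]
  have hset : Ioi 0 ⊆ interior (integrableExpSet (fun u => -u) μ) := by
    refine interior_maximal (fun N hN => ?_) isOpen_Ioi
    rw [integrableExpSet, mem_ofPred_eq, hμ, integrable_withDensity_iff_integrable_smul₀' hm hfin]
    refine (integrableOn_laplace ht (le_of_lt hN)).congr_fun (fun u hu => ?_) measurableSet_Ioi
    simp only [ENNReal.toReal_ofReal (hnn u hu), smul_eq_mul, mul_neg]
    rw [mul_comm]
  have hae : ∀ᵐ u ∂μ, 0 < u :=
    (withDensity_absolutelyContinuous _ _).ae_le (ae_restrict_mem measurableSet_Ioi)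
  rw [hmgf]
  refine ⟨(analyticOn_mgf.mono hset).contDiffOn (uniqueDiffOn_Ioi 0), fun k x hx => ?_⟩
  rw [iteratedDeriv_mgf (hset hx), ← integral_const_mul]
  refine integral_nonneg_of_ae ?_
  filter_upwards [hae] with u hu
  rw [Pi.zero_apply, ← mul_assoc, ← mul_pow, neg_one_mul, neg_neg]
  positivity

/-! ### Averaging over a Poisson number of users -/

lemma integral_exp_neg_mul_poissonMeasure (lam : ℝ≥0) (u : ℝ) :
    ∫ n : ℕ, Real.exp (-((n : ℝ) * u)) ∂(poissonMeasure lam) =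
      Real.exp (-((lam : ℝ) * (1 - Real.exp (-u)))) := by
  rw [integral_poissonMeasure]
  have h := (NormedSpace.expSeries_div_hasSum_exp ((lam : ℝ) * Real.exp (-u))).mul_left
    (Real.exp (-(lam : ℝ)))
  rw [← Real.exp_eq_exp_ℝ, ← Real.exp_add] at h
  have he : -(lam : ℝ) + lam * Real.exp (-u) = -((lam : ℝ) * (1 - Real.exp (-u))) := by ring
  rw [← he, ← h.tsum_eq]
  congr 1 with n
  rw [smul_eq_mul, mul_pow, ← Real.exp_nat_mul, mul_neg]
  ring

lemma integrable_prod_poissonMeasure {t : ℝ → ℝ} (ht : IntegrableOn t (Ioi 0)) (lam : ℝ≥0) :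
    Integrable (Function.uncurry fun (n : ℕ) (u : ℝ) => Real.exp (-((n : ℝ) * u)) * t u)
      ((poissonMeasure lam).prod (volume.restrict (Ioi 0))) := by
  have h2 : Integrable (fun z : ℕ × ℝ => t z.2)
      ((poissonMeasure lam).prod (volume.restrict (Ioi 0))) := Integrable.comp_snd ht _
  refine Integrable.bdd_mul (c := 1) h2 (by fun_prop) ?_
  have h3 : ∀ᵐ z ∂((poissonMeasure lam).prod (volume.restrict (Ioi (0 : ℝ)))), 0 < z.2 :=
    Measure.quasiMeasurePreserving_snd.ae (ae_restrict_mem measurableSet_Ioi)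
  filter_upwards [h3] with z hz
  rw [Real.norm_eq_abs, abs_of_pos (Real.exp_pos _), Real.exp_le_one_iff]
  have : 0 ≤ (z.1 : ℝ) * z.2 := by positivity
  linarith

lemma integrable_laplaceTransform_poissonMeasure {t : ℝ → ℝ} (ht : IntegrableOn t (Ioi 0))
    (lam : ℝ≥0) : Integrable (fun n : ℕ => laplaceTransform t n) (poissonMeasure lam) :=
  (integrable_prod_poissonMeasure ht lam).integral_prod_left

lemma integral_laplaceTransform_poissonMeasure {t : ℝ → ℝ} (ht : IntegrableOn t (Ioi 0))
    (lam : ℝ≥0) : ∫ n : ℕ, laplaceTransform t n ∂(poissonMeasure lam) =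
      ∫ u in Ioi 0, Real.exp (-((lam : ℝ) * (1 - Real.exp (-u)))) * t u := by
  unfold laplaceTransform
  rw [integral_integral_swap (integrable_prod_poissonMeasure ht lam)]
  congr 1 with u
  rw [integral_mul_const, integral_exp_neg_mul_poissonMeasure]

/-- Follows from `e^u ≥ 1 + u + u²/2` and `(1 - u + u²/2)(1 + u + u²/2) = 1 + u⁴/4 ≥ 1`. -/
lemma exp_neg_le_quadratic {u : ℝ} (hu : 0 ≤ u) : Real.exp (-u) ≤ 1 - u + u ^ 2 / 2 := by
  rw [Real.exp_neg, inv_le_iff_one_le_mul₀ (Real.exp_pos u)]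
  have h1 := Real.quadratic_le_exp_of_nonneg hu
  have h2 : 0 ≤ 1 - u + u ^ 2 / 2 := by nlinarith [sq_nonneg (u - 1)]
  have h3 := mul_le_mul_of_nonneg_left h1 h2
  nlinarith [sq_nonneg (u ^ 2)]

/-- The pointwise error of replacing a Poisson variable by its mean `N` in the exponent of
`e^{-N u}`. -/
lemma exp_poisson_sub_exp_bounds {N u : ℝ} (hN : 0 < N) (hu : 0 < u) :
    0 ≤ Real.exp (-(N * (1 - Real.exp (-u)))) - Real.exp (-(N * u)) ∧
    Real.exp (-(N * (1 - Real.exp (-u)))) - Real.exp (-(N * u)) ≤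
      16 / N * Real.exp (-(1 / 4 * N * u)) + Real.exp (-(N * (1 / 2))) := by
  have hw : 1 - Real.exp (-u) ≤ u := by linarith [Real.one_sub_le_exp_neg u]
  refine ⟨?_, ?_⟩
  · rw [sub_nonneg]
    gcongr
  rcases le_or_gt u 1 with h | h
  · have hq := exp_neg_le_quadratic hu.le
    set w := 1 - Real.exp (-u) with hwdef
    have hw2 : u / 2 ≤ w := by nlinarith
    have hd : u - w ≤ u ^ 2 / 2 := by rw [hwdef]; linarith
    have h1 : Real.exp (-(N * u)) = Real.exp (-(N * w)) * Real.exp (-(N * (u - w))) := by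
      rw [← Real.exp_add]; ring_nf
    have h2 : 1 - Real.exp (-(N * (u - w))) ≤ N * (u ^ 2 / 2) := by
      have := Real.one_sub_le_exp_neg (N * (u - w))
      have := mul_le_mul_of_nonneg_left hd hN.le
      linarith
    -- The decay `e^{-Nu/2}` is split in two: one factor `e^{-Nu/4}` absorbs `N u²/2`, the other
    -- survives in the bound.
    have h3 : Real.exp (-(N * w)) ≤ Real.exp (-(1 / 4 * N * u)) * Real.exp (-(1 / 4 * N * u)) := by
      rw [← Real.exp_add]
      gcongr
      have := mul_le_mul_of_nonneg_left hw2 hN.le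
      linarith
    -- With `x = N u / 4` one has `N u²/2 = 8 x²/N`, and `x²/2 ≤ e^x` yields the constant `16`.
    have h4 : N * (u ^ 2 / 2) * Real.exp (-(1 / 4 * N * u)) ≤ 16 / N := by
      have hx : 0 ≤ 1 / 4 * N * u := by positivity
      have h5 : (1 / 4 * N * u) ^ 2 / 2 ≤ Real.exp (1 / 4 * N * u) := by
        have := Real.quadratic_le_exp_of_nonneg hx
        linarith
      rw [Real.exp_neg, ← div_eq_mul_inv, div_le_div_iff₀ (Real.exp_pos _) hN]
      nlinarith
    have h6 : 0 ≤ N * (u ^ 2 / 2) := by positivity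
    calc Real.exp (-(N * w)) - Real.exp (-(N * u))
        = Real.exp (-(N * w)) * (1 - Real.exp (-(N * (u - w)))) := by rw [h1]; ring
      _ ≤ Real.exp (-(N * w)) * (N * (u ^ 2 / 2)) := by gcongr
      _ ≤ Real.exp (-(1 / 4 * N * u)) * Real.exp (-(1 / 4 * N * u)) * (N * (u ^ 2 / 2)) := by
          gcongr
      _ = N * (u ^ 2 / 2) * Real.exp (-(1 / 4 * N * u)) * Real.exp (-(1 / 4 * N * u)) := by ring
      _ ≤ 16 / N * Real.exp (-(1 / 4 * N * u)) := by gcongr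
      _ ≤ _ := le_add_of_nonneg_right (Real.exp_pos _).le
  · have h1 : Real.exp (-u) ≤ 1 / 2 := by
      have := exp_neg_le_quadratic zero_le_one
      have : Real.exp (-u) ≤ Real.exp (-1) := by gcongr
      linarith
    have h2 : Real.exp (-(N * (1 - Real.exp (-u)))) ≤ Real.exp (-(N * (1 / 2))) := by
      gcongr
      linarith
    have h3 : 0 ≤ 16 / N * Real.exp (-(1 / 4 * N * u)) := by positivity
    linarith [Real.exp_pos (-(N * u))]

/-- Averaging a regularly varying Laplace transform over a Poisson number with mean `λ`, instead
of evaluating it at `λ`, causes a relative error of order `1 / λ`. -/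
lemma integral_poisson_laplaceTransform_sub_isBigO {t : ℝ → ℝ} (ht : IntegrableOn t (Ioi 0))
    (hpos : ∀ u, 0 < u → 0 < t u) {ν : ℝ}
    (hreg : ∀ κ : ℝ, 0 < κ → Tendsto (fun u => t (κ * u) / t u) (𝓝[>] 0) (𝓝 (κ ^ (ν - 1)))) :
    (fun lam : ℝ≥0 => ∫ n : ℕ, laplaceTransform t n ∂(poissonMeasure lam) -
        laplaceTransform t lam) =O[atTop]
      fun lam : ℝ≥0 => laplaceTransform t lam / (lam : ℝ) := by
  -- The limit of the ratio of the transforms at `N/4` and `N`, plus a margin of `1`.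
  set K : ℝ := (1 / 4 : ℝ) ^ (-ν) + 1
  have hratio := (tendsto_laplaceTransform_ratio ht hpos hreg (κ := 1 / 4)
    (by norm_num)).eventually_lt_const (lt_add_one _)
  have htail := eventually_mul_exp_le_laplaceTransform ht hpos one_half_pos (∫ u in Ioi 0, t u)
  have hcoe : Tendsto ((↑) : ℝ≥0 → ℝ) atTop atTop := NNReal.tendsto_coe_atTop.2 tendsto_id
  refine Asymptotics.IsBigO.of_bound (16 * K + 1) ?_
  filter_upwards [hcoe.eventually hratio, hcoe.eventually htail,
    hcoe.eventually (eventually_gt_atTop 0)] with lam h1 h2 hN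
  generalize hNdef : (lam : ℝ) = N at *
  have hL := laplaceTransform_pos ht hpos hN.le
  have hg : IntegrableOn (fun u => Real.exp (-(N * (1 - Real.exp (-u)))) * t u) (Ioi 0) := by
    refine integrableOn_continuous_mul_of_le_one ht (by fun_prop) (fun u _ => (Real.exp_pos _).le)
      fun u hu => Real.exp_le_one_iff.2 ?_
    have h3 : Real.exp (-u) ≤ 1 := Real.exp_le_one_iff.2 (by linarith)
    have := mul_nonneg hN.le (sub_nonneg.2 h3)
    linarith
  have hN4 : 0 ≤ 1 / 4 * N := by positivity
  have hdiff : ∫ n : ℕ, laplaceTransform t n ∂(poissonMeasure lam) - laplaceTransform t N =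
      ∫ u in Ioi 0,
        (Real.exp (-(N * (1 - Real.exp (-u)))) - Real.exp (-(N * u))) * t u := by
    rw [integral_laplaceTransform_poissonMeasure ht, hNdef, laplaceTransform,
      ← integral_sub hg (integrableOn_laplace ht hN.le)]
    congr 1 with u
    ring
  have hnn : 0 ≤ ∫ u in Ioi 0,
      (Real.exp (-(N * (1 - Real.exp (-u)))) - Real.exp (-(N * u))) * t u :=
    setIntegral_nonneg measurableSet_Ioi fun u hu =>
      mul_nonneg (exp_poisson_sub_exp_bounds hN hu).1 (hpos u hu).le
  have hle : ∫ u in Ioi 0, (Real.exp (-(N * (1 - Real.exp (-u)))) - Real.exp (-(N * u))) * t u ≤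
      16 / N * laplaceTransform t (1 / 4 * N) +
        Real.exp (-(N * (1 / 2))) * ∫ u in Ioi 0, t u := by
    have hi1 := (integrableOn_laplace ht hN4).const_mul (16 / N)
    have hi2 : IntegrableOn (fun u => Real.exp (-(N * (1 / 2))) * t u) (Ioi 0) := ht.const_mul _
    have hi3 : IntegrableOn (fun u =>
        (Real.exp (-(N * (1 - Real.exp (-u)))) - Real.exp (-(N * u))) * t u) (Ioi 0) :=
      (hg.sub (integrableOn_laplace ht hN.le)).congr (ae_of_all _ fun u => (sub_mul _ _ _).symm)
    rw [laplaceTransform, ← integral_const_mul, ← integral_const_mul, ← integral_add hi1 hi2]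
    refine setIntegral_mono_on hi3 (hi1.add hi2) measurableSet_Ioi fun u hu => ?_
    have := mul_le_mul_of_nonneg_right (exp_poisson_sub_exp_bounds hN hu).2 (hpos u hu).le
    linarith
  rw [hdiff, Real.norm_eq_abs, Real.norm_eq_abs, abs_of_nonneg hnn, abs_of_pos (div_pos hL hN)]
  refine hle.trans ?_
  have h3 : laplaceTransform t (1 / 4 * N) ≤ K * laplaceTransform t N :=
    ((div_lt_iff₀ hL).1 h1).le
  have h4 : Real.exp (-(N * (1 / 2))) * ∫ u in Ioi 0, t u ≤ laplaceTransform t N / N := by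
    rw [le_div_iff₀ hN]
    linarith
  calc _ ≤ 16 / N * (K * laplaceTransform t N) + laplaceTransform t N / N := by gcongr
    _ = _ := by ring

/-! ### The Rayleigh gain and its quantile function -/

lemma cdf_rayleighGain (x : ℝ) :
    cdf rayleighGain x = if 0 ≤ x then 1 - Real.exp (-x) else 0 := by
  rw [rayleighGain, cdf_expMeasure_eq one_pos, one_mul]

lemma rayleighGainPDF_of_nonneg {x : ℝ} (hx : 0 ≤ x) : rayleighGainPDF x = Real.exp (-x) := by
  simp [rayleighGainPDF, exponentialPDFReal, gammaPDFReal, hx]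

lemma one_sub_exp_neg_pos {u : ℝ} (hu : 0 < u) : 0 < 1 - Real.exp (-u) :=
  sub_pos.2 (Real.exp_lt_one_iff.2 (neg_neg_of_pos hu))

/-- The value `F⁻¹(e^{-u})` of the quantile function of the unit exponential law. -/
noncomputable def rayleighQuantile (u : ℝ) : ℝ := -Real.log (1 - Real.exp (-u))

lemma exp_neg_rayleighQuantile {u : ℝ} (hu : 0 < u) :
    Real.exp (-rayleighQuantile u) = 1 - Real.exp (-u) := by
  rw [rayleighQuantile, neg_neg, Real.exp_log (one_sub_exp_neg_pos hu)]

lemma rayleighQuantile_pos {u : ℝ} (hu : 0 < u) : 0 < rayleighQuantile u :=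
  neg_pos.2 (Real.log_neg (one_sub_exp_neg_pos hu) (by linarith [Real.exp_pos (-u)]))

/-- The relation `e^{-q} + e^{-u} = 1` is symmetric in `q` and `u`. Being an involution, the
quantile map is a bijection of `(0, ∞)`. -/
lemma rayleighQuantile_rayleighQuantile {u : ℝ} (hu : 0 < u) :
    rayleighQuantile (rayleighQuantile u) = u := by
  rw [rayleighQuantile, exp_neg_rayleighQuantile hu, sub_sub_cancel, Real.log_exp, neg_neg]

lemma image_rayleighQuantile : rayleighQuantile '' Ioi 0 = Ioi 0 :=
  Subset.antisymm (image_subset_iff.2 fun _ hu => rayleighQuantile_pos hu) fun y hy =>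
    ⟨rayleighQuantile y, rayleighQuantile_pos hy, rayleighQuantile_rayleighQuantile hy⟩

lemma injOn_rayleighQuantile : InjOn rayleighQuantile (Ioi 0) := fun x hx y hy h => by
  rw [← rayleighQuantile_rayleighQuantile hx, h, rayleighQuantile_rayleighQuantile hy]

lemma hasDerivAt_rayleighQuantile {u : ℝ} (hu : 0 < u) :
    HasDerivAt rayleighQuantile (-(Real.exp (-u) / (1 - Real.exp (-u)))) u := by
  have h := ((((hasDerivAt_id u).neg).exp.const_sub 1).log (one_sub_exp_neg_pos hu).ne').neg
  refine h.congr_deriv ?_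
  simp

lemma inverseCDF_rayleighGain {u : ℝ} (hu : 0 < u) :
    inverseCDF rayleighGain (Real.exp (-u)) = rayleighQuantile u := by
  have h : {x : ℝ | Real.exp (-u) ≤ cdf rayleighGain x} = Ici (rayleighQuantile u) := by
    ext x
    rw [mem_ofPred_eq, mem_Ici, cdf_rayleighGain]
    split_ifs with hx
    · rw [le_sub_comm, ← exp_neg_rayleighQuantile hu, Real.exp_le_exp, neg_le_neg_iff]
    · have := rayleighQuantile_pos hu
      have := Real.exp_pos (-u)
      constructor <;> intro <;> linarith
  rw [inverseCDF, h, csInf_Ici]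

/-! ### The average error rate as a Laplace transform -/

/-- The mass that the gain of the best of `N` users puts on `[0, y]`. -/
lemma bestGainCDF_measure_Icc (γ : Measure ℝ) (N : ℝ≥0) {y : ℝ} (hy : 0 ≤ y) :
    (bestGainCDF γ N).measure (Icc 0 y) = ENNReal.ofReal (cdf γ y ^ (N : ℝ)) := by
  -- The left limit vanishes, so an atom at `0` is counted; for `N = 0` it carries all the mass.
  have h0 : Function.leftLim (bestGainCDF γ N) 0 = 0 := by
    refine leftLim_eq_of_tendsto (tendsto_const_nhds.congr' ?_)
    filter_upwards [self_mem_nhdsWithin] with x hx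
    exact (if_pos hx).symm
  have h1 : bestGainCDF γ N y = cdf γ y ^ (N : ℝ) := if_neg (not_lt.2 hy)
  rw [StieltjesFunction.measure_Icc, h0, h1, sub_zero]

lemma isFiniteMeasure_bestGainCDF_restrict (γ : Measure ℝ) (N : ℝ≥0) :
    IsFiniteMeasure ((bestGainCDF γ N).measure.restrict (Ici 0)) := by
  have h : Tendsto (bestGainCDF γ N) atTop (𝓝 1) := by
    have h1 := (tendsto_cdf_atTop γ).rpow_const (p := (N : ℝ)) (Or.inr N.2)
    rw [Real.one_rpow] at h1
    refine h1.congr' ?_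
    filter_upwards [eventually_ge_atTop 0] with x hx
    exact (if_neg (not_lt.2 hx)).symm
  exact ⟨by rw [Measure.restrict_apply_univ, StieltjesFunction.measure_Ici _ h]
            exact ENNReal.ofReal_lt_top⟩

section ErrorRate

variable {Pe b : ℝ → ℝ} {ρ : ℝ}

/-- Since the derivative has constant sign, convergence of `Pe` at infinity already gives
integrability. Only continuity is needed at `0`, where `b` may blow up like `x^{-1/2}`. -/
lemma integrableOn_errorRate_density (hρ : 0 < ρ) (hcont : ContinuousOn Pe (Ici 0))
    (hlim : Tendsto Pe atTop (𝓝 0)) (hder : ∀ x, 0 < x → HasDerivAt Pe (-b x) x)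
    (hb : ∀ x, 0 < x → 0 < b x) {x : ℝ} (hx : 0 ≤ x) :
    IntegrableOn (fun y => ρ * b (ρ * y)) (Ioi x) ∧
      ∫ y in Ioi x, ρ * b (ρ * y) = Pe (ρ * x) := by
  have hcont' : ContinuousWithinAt (fun y => Pe (ρ * y)) (Ici x) x :=
    (hcont (ρ * x) (mul_nonneg hρ.le hx)).comp (by fun_prop)
      fun y hy => mul_nonneg hρ.le (hx.trans hy)
  have hder' : ∀ y ∈ Ioi x, HasDerivAt (fun y => Pe (ρ * y)) (-(ρ * b (ρ * y))) y := by
    intro y hy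
    have h := (hder (ρ * y) (mul_pos hρ (hx.trans_lt hy))).comp y ((hasDerivAt_id y).const_mul ρ)
    refine h.congr_deriv ?_
    ring
  have hneg : ∀ y ∈ Ioi x, -(ρ * b (ρ * y)) ≤ 0 := fun y hy =>
    neg_nonpos.2 (mul_pos hρ (hb _ (mul_pos hρ (hx.trans_lt hy)))).le
  have hlim' : Tendsto (fun y => Pe (ρ * y)) atTop (𝓝 0) :=
    hlim.comp (tendsto_id.const_mul_atTop hρ)
  refine ⟨integrable_neg_iff.1 (integrableOn_Ioi_deriv_of_nonpos hcont' hder' hneg hlim'), ?_⟩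
  have h := integral_Ioi_of_hasDerivAt_of_nonpos hcont' hder' hneg hlim'
  rw [integral_neg] at h
  linarith

/-- Integration by parts: the average error rate as an integral against the density of the
instantaneous error rate. -/
lemma averageErrorRate_eq_integral_cdf_rpow (γ : Measure ℝ) (hρ : 0 < ρ)
    (hcont : ContinuousOn Pe (Ici 0)) (hlim : Tendsto Pe atTop (𝓝 0))
    (hder : ∀ x, 0 < x → HasDerivAt Pe (-b x) x) (hb : ∀ x, 0 < x → 0 < b x) {N : ℝ}
    (hN : 0 ≤ N) :
    averageErrorRate γ Pe ρ N = ∫ y in Ioi 0, cdf γ y ^ N * (ρ * b (ρ * y)) := by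
  have := isFiniteMeasure_bestGainCDF_restrict γ N.toNNReal
  have hg := (integrableOn_errorRate_density hρ hcont hlim hder hb le_rfl).1
  set μ := (bestGainCDF γ N.toNNReal).measure with hμ
  -- The kernel `1_{x ≤ y}` writes `Pe (ρ x)` as an integral over `y ≥ x`; swapping the integrals
  -- leaves the mass of `[0, y]`.
  have hprod : Integrable (Function.uncurry fun x y : ℝ =>
      (Iic y).indicator (1 : ℝ → ℝ) x * (ρ * b (ρ * y)))
      ((μ.restrict (Ici 0)).prod (volume.restrict (Ioi 0))) := by
    have h2 : Integrable (fun z : ℝ × ℝ => ρ * b (ρ * z.2))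
        ((μ.restrict (Ici 0)).prod (volume.restrict (Ioi 0))) := Integrable.comp_snd hg _
    refine Integrable.bdd_mul (c := 1) h2 ?_ (ae_of_all _ fun z => ?_)
    · exact ((measurable_const (a := (1 : ℝ))).indicator
        (measurableSet_le measurable_fst measurable_snd)).aestronglyMeasurable
    · rw [Real.norm_eq_abs]
      unfold indicator
      split_ifs <;> simp
  calc averageErrorRate γ Pe ρ N
      = ∫ x in Ici 0, (∫ y in Ioi 0,
          (Iic y).indicator (1 : ℝ → ℝ) x * (ρ * b (ρ * y))) ∂μ := by
        refine setIntegral_congr_fun measurableSet_Ici fun x hx => ?_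
        have h : ∀ y, (Iic y).indicator (1 : ℝ → ℝ) x * (ρ * b (ρ * y)) =
            (Ici x).indicator (fun y => ρ * b (ρ * y)) y := fun y => by
          simp [indicator]
        simp only [h]
        rw [← integral_Ici_eq_integral_Ioi, setIntegral_indicator measurableSet_Ici,
          inter_eq_self_of_subset_right (Ici_subset_Ici.2 hx), integral_Ici_eq_integral_Ioi,
          (integrableOn_errorRate_density hρ hcont hlim hder hb hx).2]
    _ = ∫ y in Ioi 0, (∫ x in Ici 0,
          (Iic y).indicator (1 : ℝ → ℝ) x * (ρ * b (ρ * y)) ∂μ) := integral_integral_swap hprod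
    _ = _ := by
        refine setIntegral_congr_fun measurableSet_Ioi fun y hy => ?_
        have hy : 0 < y := hy
        rw [integral_mul_const, integral_indicator_one measurableSet_Iic, measureReal_def,
          Measure.restrict_apply measurableSet_Iic, inter_comm, Ici_inter_Iic, hμ,
          bestGainCDF_measure_Icc γ _ hy.le, Real.coe_toNNReal _ hN,
          ENNReal.toReal_ofReal (Real.rpow_nonneg (cdf_nonneg γ y) N)]

lemma mixingDensity_rayleigh (hρ : 0 < ρ) (hder : ∀ x, 0 < x → HasDerivAt Pe (-b x) x)
    {u : ℝ} (hu : 0 < u) :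
    mixingDensity rayleighGain rayleighGainPDF Pe ρ u =
      Real.exp (-u) / (1 - Real.exp (-u)) * (ρ * b (ρ * rayleighQuantile u)) := by
  have hq := rayleighQuantile_pos hu
  rw [mixingDensity, inverseCDF_rayleighGain hu, rayleighGainPDF_of_nonneg hq.le,
    exp_neg_rayleighQuantile hu, (hder _ (mul_pos hρ hq)).deriv, neg_neg]
  ring

lemma mixingDensity_rayleigh_pos (hρ : 0 < ρ) (hder : ∀ x, 0 < x → HasDerivAt Pe (-b x) x)
    (hb : ∀ x, 0 < x → 0 < b x) {u : ℝ} (hu : 0 < u) :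
    0 < mixingDensity rayleighGain rayleighGainPDF Pe ρ u := by
  rw [mixingDensity_rayleigh hρ hder hu]
  have := one_sub_exp_neg_pos hu
  have := hb _ (mul_pos hρ (rayleighQuantile_pos hu))
  positivity

lemma abs_deriv_rayleighQuantile {u : ℝ} (hu : 0 < u) :
    |-(Real.exp (-u) / (1 - Real.exp (-u)))| = Real.exp (-u) / (1 - Real.exp (-u)) := by
  rw [abs_neg, abs_of_pos (div_pos (Real.exp_pos _) (one_sub_exp_neg_pos hu))]

lemma integrableOn_mixingDensity_rayleigh (hρ : 0 < ρ) (hcont : ContinuousOn Pe (Ici 0))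
    (hlim : Tendsto Pe atTop (𝓝 0)) (hder : ∀ x, 0 < x → HasDerivAt Pe (-b x) x)
    (hb : ∀ x, 0 < x → 0 < b x) :
    IntegrableOn (mixingDensity rayleighGain rayleighGainPDF Pe ρ) (Ioi 0) := by
  have h := (integrableOn_errorRate_density hρ hcont hlim hder hb le_rfl).1
  rw [← image_rayleighQuantile, integrableOn_image_iff_integrableOn_abs_deriv_smul
    measurableSet_Ioi (fun u hu => (hasDerivAt_rayleighQuantile hu).hasDerivWithinAt)
    injOn_rayleighQuantile] at h
  refine h.congr_fun (fun u hu => ?_) measurableSet_Ioi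
  beta_reduce
  rw [abs_deriv_rayleighQuantile hu, smul_eq_mul, mixingDensity_rayleigh hρ hder hu]

/-- The average error rate under Rayleigh fading is the Laplace transform of the mixing density. -/
lemma averageErrorRate_rayleigh_eq_laplaceTransform (hρ : 0 < ρ)
    (hcont : ContinuousOn Pe (Ici 0)) (hlim : Tendsto Pe atTop (𝓝 0))
    (hder : ∀ x, 0 < x → HasDerivAt Pe (-b x) x) (hb : ∀ x, 0 < x → 0 < b x) {N : ℝ}
    (hN : 0 ≤ N) :
    averageErrorRate rayleighGain Pe ρ N =
      laplaceTransform (mixingDensity rayleighGain rayleighGainPDF Pe ρ) N := by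
  rw [averageErrorRate_eq_integral_cdf_rpow _ hρ hcont hlim hder hb hN]
  -- Substituting `y = rayleighQuantile u` turns `F(y)^N` into `e^{-Nu}`; the Jacobian `e^{-u} / (1
  -- - e^{-u})` is the factor `e^{-u} / f` in `t`.
  nth_rewrite 1 [← image_rayleighQuantile]
  rw [integral_image_eq_integral_abs_deriv_smul measurableSet_Ioi
    (fun u hu => (hasDerivAt_rayleighQuantile hu).hasDerivWithinAt) injOn_rayleighQuantile,
    laplaceTransform]
  refine setIntegral_congr_fun measurableSet_Ioi fun u hu => ?_
  rw [abs_deriv_rayleighQuantile hu, smul_eq_mul, mixingDensity_rayleigh hρ hder hu,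
    cdf_rayleighGain, if_pos (rayleighQuantile_pos hu).le, exp_neg_rayleighQuantile hu,
    sub_sub_cancel, ← Real.exp_mul]
  ring_nf

end ErrorRate

/-! ### Regular variation of the mixing density at zero -/

lemma tendsto_const_mul_nhdsGT_zero {κ : ℝ} (hκ : 0 < κ) :
    Tendsto (fun u : ℝ => κ * u) (𝓝[>] 0) (𝓝[>] 0) := by
  refine tendsto_nhdsWithin_iff.2 ⟨?_, ?_⟩
  · have h : Tendsto (fun u : ℝ => κ * u) (𝓝 0) (𝓝 (κ * 0)) := by
      exact (continuous_const_mul κ).tendsto 0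
    rw [mul_zero] at h
    exact h.mono_left nhdsWithin_le_nhds
  · filter_upwards [self_mem_nhdsWithin] with u hu
    exact mul_pos hκ hu

lemma tendsto_one_sub_exp_neg_div_self :
    Tendsto (fun u : ℝ => (1 - Real.exp (-u)) / u) (𝓝[>] 0) (𝓝 1) := by
  have h : HasDerivAt (fun u : ℝ => 1 - Real.exp (-u)) 1 0 := by
    have := ((hasDerivAt_id (0 : ℝ)).neg).exp.const_sub 1
    refine this.congr_deriv ?_
    simp
  have h2 := h.tendsto_slope_zero_right
  refine h2.congr fun u => ?_
  simp [div_eq_inv_mul]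

lemma tendsto_one_sub_exp_neg_ratio {κ : ℝ} (hκ : 0 < κ) :
    Tendsto (fun u : ℝ => (1 - Real.exp (-(κ * u))) / (1 - Real.exp (-u))) (𝓝[>] 0) (𝓝 κ) := by
  have h1 := tendsto_one_sub_exp_neg_div_self
  have h := ((h1.comp (tendsto_const_mul_nhdsGT_zero hκ)).div h1 one_ne_zero).const_mul κ
  rw [div_one, mul_one] at h
  refine h.congr' ?_
  filter_upwards [self_mem_nhdsWithin] with u hu
  have hu : 0 < u := hu
  have := (one_sub_exp_neg_pos hu).ne'
  simp only [Pi.div_apply, Function.comp_apply]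
  field_simp

lemma tendsto_rayleighQuantile_atTop : Tendsto rayleighQuantile (𝓝[>] 0) atTop := by
  refine tendsto_neg_atBot_atTop.comp (Real.tendsto_log_nhdsGT_zero.comp
    (tendsto_nhdsWithin_iff.2 ⟨?_, ?_⟩))
  · have h : Tendsto (fun u : ℝ => 1 - Real.exp (-u)) (𝓝 0) (𝓝 (1 - Real.exp (-0))) := by
      exact Continuous.tendsto (by fun_prop) 0
    rw [neg_zero, Real.exp_zero, sub_self] at h
    exact h.mono_left nhdsWithin_le_nhds
  · filter_upwards [self_mem_nhdsWithin] with u hu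
    exact one_sub_exp_neg_pos hu

/-- The quantile function `u ↦ F⁻¹(e^{-u})` of the exponential law varies slowly at `0`. -/
lemma slowlyVarying_rayleighQuantile : SlowlyVarying (𝓝[>] 0) rayleighQuantile := by
  intro κ hκ
  -- Dilation by `κ` shifts the quantile by a quantity tending to `-log κ`, while the quantile
  -- itself tends to infinity.
  have h1 := ((tendsto_one_sub_exp_neg_ratio hκ).log hκ.ne').div_atTop
    tendsto_rayleighQuantile_atTop
  have h := h1.const_sub 1
  rw [sub_zero] at h
  refine h.congr' ?_
  filter_upwards [self_mem_nhdsWithin] with u hu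
  have hu : 0 < u := hu
  have hq := (rayleighQuantile_pos hu).ne'
  rw [Real.log_div (one_sub_exp_neg_pos (mul_pos hκ hu)).ne' (one_sub_exp_neg_pos hu).ne', eq_comm,
    div_eq_iff hq, sub_mul, div_mul_cancel₀ _ hq, rayleighQuantile, rayleighQuantile]
  ring

/-- The mixing density of an error rate with derivative `-C x^{-a} e^{-β x}` under Rayleigh fading
varies regularly at `0`. -/
lemma tendsto_mixingDensity_rayleigh_ratio {Pe : ℝ → ℝ} {ρ C a β : ℝ} (hρ : 0 < ρ) (hC : 0 < C)
    (hder : ∀ x, 0 < x → HasDerivAt Pe (-(C * x ^ (-a) * Real.exp (-(β * x)))) x)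
    {κ : ℝ} (hκ : 0 < κ) :
    Tendsto (fun u => mixingDensity rayleighGain rayleighGainPDF Pe ρ (κ * u) /
      mixingDensity rayleighGain rayleighGainPDF Pe ρ u) (𝓝[>] 0) (𝓝 (κ ^ (β * ρ - 1))) := by
  -- The `-1` in the exponent is the division by the density `f = 1 - e^{-u}`.
  have hform : ∀ u, 0 < u → mixingDensity rayleighGain rayleighGainPDF Pe ρ u =
      ρ * C * ρ ^ (-a) * (rayleighQuantile u ^ (-a) *
        (1 - Real.exp (-u)) ^ (β * ρ - 1) * Real.exp (-u)) := by
    intro u hu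
    have hw := one_sub_exp_neg_pos hu
    have hexp : Real.exp (-(β * (ρ * rayleighQuantile u))) = (1 - Real.exp (-u)) ^ (β * ρ) := by
      rw [← exp_neg_rayleighQuantile hu, ← Real.exp_mul]
      ring_nf
    rw [mixingDensity_rayleigh hρ hder hu, hexp, Real.mul_rpow hρ.le (rayleighQuantile_pos hu).le,
      Real.rpow_sub_one hw.ne']
    ring
  have he : Tendsto (fun u : ℝ => Real.exp (u - κ * u)) (𝓝[>] 0) (𝓝 1) := by
    have h : Tendsto (fun u : ℝ => Real.exp (u - κ * u)) (𝓝 0) (𝓝 (Real.exp (0 - κ * 0))) := by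
      exact Continuous.tendsto (by fun_prop) 0
    rw [mul_zero, sub_self, Real.exp_zero] at h
    exact h.mono_left nhdsWithin_le_nhds
  have h1 := (slowlyVarying_rayleighQuantile κ hκ).rpow_const (p := -a) (Or.inl one_ne_zero)
  have h2 := (tendsto_one_sub_exp_neg_ratio hκ).rpow_const (p := β * ρ - 1) (Or.inl hκ.ne')
  have h := (h1.mul h2).mul he
  rw [Real.one_rpow, one_mul, mul_one] at h
  refine h.congr' ?_
  filter_upwards [self_mem_nhdsWithin] with u hu
  have hu : 0 < u := hu
  have hκu := mul_pos hκ hu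
  have hρa := Real.rpow_pos_of_pos hρ (-a)
  rw [hform u hu, hform _ hκu, mul_div_mul_left _ _ (by positivity),
    Real.div_rpow (rayleighQuantile_pos hκu).le (rayleighQuantile_pos hu).le,
    Real.div_rpow (one_sub_exp_neg_pos hκu).le (one_sub_exp_neg_pos hu).le,
    div_mul_div_comm, mul_div_mul_comm (_ * _) (Real.exp _), ← Real.exp_sub]
  ring_nf

/-- Needed because the Laplace representation is available only for `N ≥ 0`. -/
lemma CompletelyMonotonic.congr {f g : ℝ → ℝ} (hf : CompletelyMonotonic f)
    (h : ∀ x, 0 < x → g x = f x) : CompletelyMonotonic g := by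
  refine ⟨hf.1.congr fun x hx => h x hx, fun k x hx => ?_⟩
  have he : g =ᶠ[𝓝 x] f := by
    filter_upwards [Ioi_mem_nhds hx] with y hy using h y hy
  rw [he.iteratedDeriv_eq k]
  exact hf.2 k x hx

/-- The conclusions for any error rate that vanishes at infinity and has derivative
`-C x^{-a} e^{-β x}`. -/
theorem rayleigh_errorRate_asymptotics {Pe : ℝ → ℝ} {ρ C a β : ℝ} (hρ : 0 < ρ) (hC : 0 < C)
    (hcont : ContinuousOn Pe (Ici 0)) (hlim : Tendsto Pe atTop (𝓝 0))
    (hder : ∀ x, 0 < x → HasDerivAt Pe (-(C * x ^ (-a) * Real.exp (-(β * x)))) x) :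
    RegularlyVarying (𝓝[>] 0) (β * ρ - 1) (mixingDensity rayleighGain rayleighGainPDF Pe ρ) ∧
      CompletelyMonotonic (averageErrorRate rayleighGain Pe ρ) ∧
      RegularlyVarying atTop (-(β * ρ)) (averageErrorRate rayleighGain Pe ρ) ∧
      (∀ lam : ℝ≥0, Integrable (fun n : ℕ => averageErrorRate rayleighGain Pe ρ (n : ℝ))
        (poissonMeasure lam)) ∧
      (fun lam : ℝ≥0 => poissonErrorRate rayleighGain Pe ρ lam -
          averageErrorRate rayleighGain Pe ρ (lam : ℝ))
        =O[atTop] fun lam : ℝ≥0 => averageErrorRate rayleighGain Pe ρ (lam : ℝ) / (lam : ℝ) := by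
  have hb : ∀ x : ℝ, 0 < x → 0 < C * x ^ (-a) * Real.exp (-(β * x)) := fun x hx => by positivity
  have hint := integrableOn_mixingDensity_rayleigh hρ hcont hlim hder hb
  have hpos : ∀ u, 0 < u → 0 < mixingDensity rayleighGain rayleighGainPDF Pe ρ u :=
    fun u hu => mixingDensity_rayleigh_pos hρ hder hb hu
  have hreg := fun κ hκ => tendsto_mixingDensity_rayleigh_ratio hρ hC hder (κ := κ) hκ
  have hrep : ∀ N : ℝ, 0 ≤ N → averageErrorRate rayleighGain Pe ρ N =
      laplaceTransform (mixingDensity rayleighGain rayleighGainPDF Pe ρ) N :=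
    fun N hN => averageErrorRate_rayleigh_eq_laplaceTransform hρ hcont hlim hder hb hN
  refine ⟨regularlyVarying_of_tendsto self_mem_nhdsWithin hreg,
    (completelyMonotonic_laplaceTransform hint fun u hu => (hpos u hu).le).congr
      fun N hN => hrep N hN.le,
    regularlyVarying_of_tendsto (eventually_gt_atTop 0) fun κ hκ => ?_, fun lam => ?_, ?_⟩
  · refine (tendsto_laplaceTransform_ratio hint hpos hreg hκ).congr' ?_
    filter_upwards [eventually_ge_atTop 0] with N hN
    rw [hrep N hN, hrep _ (mul_nonneg hκ.le hN)]
  -- The representation must include `N = 0`, which the Poisson law charges.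
  · simp only [hrep _ (Nat.cast_nonneg _)]
    exact integrable_laplaceTransform_poissonMeasure hint lam
  · unfold poissonErrorRate
    simp only [hrep _ (Nat.cast_nonneg _), hrep _ (NNReal.coe_nonneg _)]
    exact integral_poisson_laplaceTransform_sub_isBigO hint hpos hreg

/-! ### The two error rates -/

lemma integrable_exp_neg_sq_div_two : Integrable fun s : ℝ => Real.exp (-(s ^ 2) / 2) := by
  refine (integrable_exp_neg_mul_sq (b := 1 / 2) (by norm_num)).congr (ae_of_all _ fun s => ?_)
  ring_nf

lemma gaussianQ_eq_sub (x : ℝ) : gaussianQ x = 1 / Real.sqrt (2 * Real.pi) *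
    ((∫ s in Ioi (0 : ℝ), Real.exp (-(s ^ 2) / 2)) - ∫ s in (0 : ℝ)..x, Real.exp (-(s ^ 2) / 2)) := by
  have hi := integrable_exp_neg_sq_div_two
  rw [gaussianQ, ← intervalIntegral.integral_Ioi_sub_Ioi' hi.integrableOn hi.integrableOn,
    sub_sub_cancel]

lemma hasDerivAt_gaussianQ (x : ℝ) :
    HasDerivAt gaussianQ (1 / Real.sqrt (2 * Real.pi) * -Real.exp (-(x ^ 2) / 2)) x := by
  have hc : Continuous fun s : ℝ => Real.exp (-(s ^ 2) / 2) := by fun_prop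
  rw [funext gaussianQ_eq_sub]
  exact ((hc.integral_hasStrictDerivAt 0 x).hasDerivAt.const_sub _).const_mul _

lemma tendsto_gaussianQ_atTop : Tendsto gaussianQ atTop (𝓝 0) := by
  have h := ((intervalIntegral_tendsto_integral_Ioi 0
    integrable_exp_neg_sq_div_two.integrableOn tendsto_id).const_sub
    (∫ s in Ioi (0 : ℝ), Real.exp (-(s ^ 2) / 2))).const_mul (1 / Real.sqrt (2 * Real.pi))
  rw [sub_self, mul_zero] at h
  rw [funext gaussianQ_eq_sub]
  exact h

lemma hasDerivAt_expErrorRate (α η x : ℝ) :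
    HasDerivAt (expErrorRate α η) (-(α * η * Real.exp (-(η * x)))) x := by
  have h := (((hasDerivAt_id x).const_mul η).neg.exp).const_mul α
  refine h.congr_deriv ?_
  simp only [Pi.neg_apply, id, mul_one]
  ring

lemma tendsto_expErrorRate_atTop (α : ℝ) {η : ℝ} (hη : 0 < η) :
    Tendsto (expErrorRate α η) atTop (𝓝 0) := by
  have h := (Real.tendsto_exp_neg_atTop_nhds_zero.comp
    (tendsto_id.const_mul_atTop hη)).const_mul α
  rw [mul_zero] at h
  exact h

lemma continuous_qErrorRate (α η : ℝ) : Continuous (qErrorRate α η) := by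
  have h : Continuous gaussianQ :=
    continuous_iff_continuousAt.2 fun x => (hasDerivAt_gaussianQ x).continuousAt
  exact (h.comp (by fun_prop : Continuous fun x => Real.sqrt (η * x))).const_mul α

lemma tendsto_qErrorRate_atTop (α : ℝ) {η : ℝ} (hη : 0 < η) :
    Tendsto (qErrorRate α η) atTop (𝓝 0) := by
  have h := (tendsto_gaussianQ_atTop.comp
    (Real.tendsto_sqrt_atTop.comp (tendsto_id.const_mul_atTop hη))).const_mul α
  rw [mul_zero] at h
  exact h

/-- The Gaussian density at `√(ηx)` gives `e^{-ηx/2}`, and the inner derivative gives `x^{-1/2}`: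
this is the form with `a = 1/2`, `β = η/2`. -/
lemma hasDerivAt_qErrorRate (α : ℝ) {η x : ℝ} (hη : 0 < η) (hx : 0 < x) :
    HasDerivAt (qErrorRate α η) (-(α * (1 / Real.sqrt (2 * Real.pi)) * (Real.sqrt η / 2) *
      x ^ (-(1 / 2) : ℝ) * Real.exp (-(η / 2 * x)))) x := by
  have hηx := mul_pos hη hx
  have h := ((hasDerivAt_gaussianQ (Real.sqrt (η * x))).comp x
    (((hasDerivAt_id x).const_mul η).sqrt hηx.ne')).const_mul α
  refine h.congr_deriv ?_
  have h1 : -(η * x) / 2 = -(η / 2 * x) := by ring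
  have h2 : η / (2 * Real.sqrt (η * x)) = Real.sqrt η / 2 * x ^ (-(1 / 2) : ℝ) := by
    rw [Real.rpow_neg hx.le, ← Real.sqrt_eq_rpow, Real.sqrt_mul hη.le]
    have h3 := Real.sqrt_pos.2 hη
    have h4 := Real.sqrt_pos.2 hx
    field_simp
    rw [Real.sq_sqrt hη.le]
  simp only [id, mul_one]
  rw [Real.sq_sqrt hηx.le, h1, h2]
  ring

theorem mainTheorem4 (α η ρ : ℝ) (hα : 0 < α) (hη : 0 < η) (hρ : 0 < ρ) :
    (RegularlyVarying (𝓝[>] 0) (η * ρ - 1)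
        (mixingDensity rayleighGain rayleighGainPDF (expErrorRate α η) ρ) ∧
      CompletelyMonotonic (averageErrorRate rayleighGain (expErrorRate α η) ρ) ∧
      RegularlyVarying atTop (-(η * ρ)) (averageErrorRate rayleighGain (expErrorRate α η) ρ) ∧
      (∀ lam : ℝ≥0, Integrable
        (fun n : ℕ => averageErrorRate rayleighGain (expErrorRate α η) ρ (n : ℝ))
        (poissonMeasure lam)) ∧
      (fun lam : ℝ≥0 => poissonErrorRate rayleighGain (expErrorRate α η) ρ lam -
          averageErrorRate rayleighGain (expErrorRate α η) ρ (lam : ℝ))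
        =O[atTop] fun lam : ℝ≥0 =>
          averageErrorRate rayleighGain (expErrorRate α η) ρ (lam : ℝ) / (lam : ℝ)) ∧
    (RegularlyVarying (𝓝[>] 0) (η * ρ / 2 - 1)
        (mixingDensity rayleighGain rayleighGainPDF (qErrorRate α η) ρ) ∧
      CompletelyMonotonic (averageErrorRate rayleighGain (qErrorRate α η) ρ) ∧
      RegularlyVarying atTop (-(η * ρ / 2)) (averageErrorRate rayleighGain (qErrorRate α η) ρ) ∧
      (∀ lam : ℝ≥0, Integrable
        (fun n : ℕ => averageErrorRate rayleighGain (qErrorRate α η) ρ (n : ℝ))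
        (poissonMeasure lam)) ∧
      (fun lam : ℝ≥0 => poissonErrorRate rayleighGain (qErrorRate α η) ρ lam -
          averageErrorRate rayleighGain (qErrorRate α η) ρ (lam : ℝ))
        =O[atTop] fun lam : ℝ≥0 =>
          averageErrorRate rayleighGain (qErrorRate α η) ρ (lam : ℝ) / (lam : ℝ)) := by
  refine ⟨rayleigh_errorRate_asymptotics (a := 0) hρ (mul_pos hα hη)
    (fun x _ => (hasDerivAt_expErrorRate α η x).continuousAt.continuousWithinAt)
    (tendsto_expErrorRate_atTop α hη) fun x _ => ?_, ?_⟩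
  · rw [neg_zero, Real.rpow_zero, mul_one]
    exact hasDerivAt_expErrorRate α η x
  · rw [mul_div_right_comm]
    have := Real.sqrt_pos.2 hη
    exact rayleigh_errorRate_asymptotics (a := 1 / 2) (β := η / 2) hρ (by positivity)
      (continuous_qErrorRate α η).continuousOn (tendsto_qErrorRate_atTop α hη)
      fun x hx => hasDerivAt_qErrorRate α hη hx
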